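/- Let $L = U^{\oplus 3}\oplus\langle -6\rangle$, where $U$ is the hyperbolic plane (the Beauville–Bogomolov–Fujiki lattice of deformation generalised Kummer 4-folds, of signature $(3,4)$). Let $p>3$ be a prime, and let $h = h_{2p^2}\in L$ be a primitive vector that is split, i.e. $(h,L)=\mathbb{Z}$, and has degree $h^2 = 2p^2$. Let $\operatorname{O}^+(L,h)$ be the group of isometries $g$ of $L$ with $gh=h$ and real spinor norm $1$, where the real spinor norm of a product of reflections of $L\otimes\mathbb{R}$ in non-isotropic vectors $v_1,\dots,v_k$ is the sign of $\prod_i\bigl(-(v_i,v_i)\bigr)$. Let $\mathcal{F}_{2p^2} = \mathcal{D}_{h^\perp}/\operatorname{O}^+(L,h)$ be the associated orthogonal modular 4-fold, where $\mathcal{D}_{h^\perp}$ is a connected component of $\{[x]\in\mathbb{P}(h^\perp\otimes\mathbb{C}) : (x,x)=0,\ (x,\bar x)>0\}$. The boundary curves of $\mathcal{F}_{2p^2}$ are the orbits of $\operatorname{O}^+(L,h)$ on the set of primitive totally isotropic sublattices of rank $2$ of $h^\perp\subset L$. Then $\mathcal{F}_{2p^2}$ has only finitely many boundary curves, and their number is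 at most $160(p^5+p^2)$. -/

import Mathlib

namespace KummerLattice

/-- The Gram matrix of `U ⊕ U ⊕ U ⊕ ⟨-6⟩`, where `U` is the hyperbolic plane with its standard
basis. -/
def gram : Matrix (Fin 7) (Fin 7) ℤ :=
  !![0, 1, 0, 0, 0, 0,  0;
     1, 0, 0, 0, 0, 0,  0;
     0, 0, 0, 1, 0, 0,  0;
     0, 0, 1, 0, 0, 0,  0;
     0, 0, 0, 0, 0, 1,  0;
     0, 0, 0, 0, 1, 0,  0;
     0, 0, 0, 0, 0, 0, -6]

/-- The underlying group of the lattice `L = U ⊕ U ⊕ U ⊕ ⟨-6⟩`, the Beauville-Bogomolov-Fujiki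
lattice `H²(X, ℤ)` of a deformation generalised Kummer 4-fold `X`. -/
abbrev L : Type := Fin 7 → ℤ

/-- The real vector space `L ⊗ ℝ`. -/
abbrev LReal : Type := Fin 7 → ℝ

/-- The bilinear form of the lattice `L`. -/
noncomputable def form : LinearMap.BilinForm ℤ L := Matrix.toBilin' gram

/-- The bilinear form of `L ⊗ ℝ`, of signature `(3, 4)`. -/
noncomputable def realForm : LinearMap.BilinForm ℝ LReal :=
  Matrix.toBilin' (gram.map (Int.cast : ℤ → ℝ))

/-- A lattice vector is primitive if it is nonzero and not a proper multiple of a lattice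
vector. -/
def IsPrimitive (h : L) : Prop :=
  h ≠ 0 ∧ ∀ (m : ℤ) (x : L), h = m • x → IsUnit m

/-- The divisor `div(h)`: the non-negative generator of the ideal `(h, L)` of `ℤ`. -/
noncomputable def divisor (h : L) : ℕ :=
  (Submodule.IsPrincipal.generator (LinearMap.range (form h))).natAbs

/-- `h` is split if `div(h) = 1`. -/
def IsSplit (h : L) : Prop := divisor h = 1

/-- The orthogonal complement `h^⊥ ⊆ L`. -/
noncomputable def perp (h : L) : Submodule ℤ L := LinearMap.ker (form h)

/-- The orthogonal group `O(L)`. -/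
def orthogonalGroup : Subgroup (L ≃ₗ[ℤ] L) where
  carrier := {g | ∀ x y, form (g x) (g y) = form x y}
  one_mem' := fun _ _ => rfl
  mul_mem' := by
    intro a b ha hb x y
    exact (ha (b x) (b y)).trans (hb x y)
  inv_mem' := by
    intro a ha x y
    have h := ha (a⁻¹ x) (a⁻¹ y)
    have e : ∀ z, a (a⁻¹ z) = z := fun z => a.apply_symm_apply z
    rw [e, e] at h
    exact h.symm

/-- The extension `g ⊗ ℝ` of `g` to `L ⊗ ℝ`. -/
noncomputable def extendReal (g : L ≃ₗ[ℤ] L) : Module.End ℝ LReal :=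
  Matrix.toLin' ((LinearMap.toMatrix' (g : L →ₗ[ℤ] L)).map (Int.cast : ℤ → ℝ))

/-- The reflection `x ↦ x - (2 (v, x) / (v, v)) v` of `L ⊗ ℝ` (for `(v, v) ≠ 0`). -/
noncomputable def reflection (v : LReal) : Module.End ℝ LReal :=
  LinearMap.id - (2 / realForm v v) • (realForm v).smulRight v

/-- `g` has real spinor norm `1`. The real spinor norm takes values in `ℝˣ / (ℝˣ)² = {±1}`. For a
product of reflections in `v₁, …, vₖ` it is the sign of `∏ᵢ -(vᵢ, vᵢ)`. (With this normalisation
its kernel is the subgroup that preserves the orientation of maximal positive definite subspaces;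
hence elements of the kernel that fix a vector `h` with `(h, h) > 0` preserve each of the two
components of the period domain of `h^⊥`.) -/
def HasSpinorNormOne (g : L ≃ₗ[ℤ] L) : Prop :=
  ∃ vs : List LReal, (∀ v ∈ vs, realForm v v ≠ 0) ∧
    extendReal g = (vs.map reflection).prod ∧
    0 < (vs.map fun v => -realForm v v).prod

theorem extendReal_one : extendReal 1 = 1 := by
  have h : ((1 : L ≃ₗ[ℤ] L) : L →ₗ[ℤ] L) = LinearMap.id := rfl
  rw [extendReal, h, LinearMap.toMatrix'_id, Matrix.map_one _ Int.cast_zero Int.cast_one,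
    Matrix.toLin'_one]
  rfl

theorem extendReal_mul (a b : L ≃ₗ[ℤ] L) :
    extendReal (a * b) = extendReal a * extendReal b := by
  have h : ((a * b : L ≃ₗ[ℤ] L) : L →ₗ[ℤ] L) = (a : L →ₗ[ℤ] L) ∘ₗ (b : L →ₗ[ℤ] L) := rfl
  rw [extendReal, h, LinearMap.toMatrix'_comp]
  have h2 := Matrix.map_mul (L := LinearMap.toMatrix' (a : L →ₗ[ℤ] L))
    (M := LinearMap.toMatrix' (b : L →ₗ[ℤ] L)) (f := Int.castRingHom ℝ)
  simp only [Int.coe_castRingHom] at h2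
  rw [h2, Matrix.toLin'_mul]
  rfl

theorem reflection_mul_self (v : LReal) (hv : realForm v v ≠ 0) :
    reflection v * reflection v = 1 := by
  refine LinearMap.ext fun x => ?_
  simp only [reflection, Module.End.mul_apply, LinearMap.sub_apply, LinearMap.id_apply,
    LinearMap.smul_apply, LinearMap.smulRight_apply, map_sub, map_smul, Module.End.one_apply,
    smul_smul]
  funext i
  simp only [Pi.sub_apply, Pi.smul_apply, smul_eq_mul]
  field_simp
  ring

theorem prod_reflection_mul_reverse (vs : List LReal) (hvs : ∀ v ∈ vs, realForm v v ≠ 0) :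
    (vs.map reflection).prod * (vs.reverse.map reflection).prod = 1 := by
  induction vs with
  | nil => simp
  | cons v t ih =>
    have h1 := ih fun w hw => hvs w (List.mem_cons_of_mem _ hw)
    have h2 := reflection_mul_self v (hvs v List.mem_cons_self)
    simp only [List.map_cons, List.prod_cons, List.reverse_cons, List.map_append,
      List.prod_append, List.map_nil, List.prod_nil, mul_one]
    calc reflection v * (t.map reflection).prod * ((t.reverse.map reflection).prod * reflection v)
        = reflection v * ((t.map reflection).prod * (t.reverse.map reflection).prod)
            * reflection v := by simp only [mul_assoc]
      _ = 1 := by rw [h1, mul_one, h2]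

/-- The group `O⁺(L, h)`: the isometries of `L` of real spinor norm `1` that fix `h`. -/
noncomputable def orthogonalPlus (h : L) : Subgroup (L ≃ₗ[ℤ] L) where
  carrier := {g | g ∈ orthogonalGroup ∧ g h = h ∧ HasSpinorNormOne g}
  one_mem' := ⟨one_mem _, rfl, [], by simp, by simp [extendReal_one], by simp⟩
  mul_mem' := by
    rintro a b ⟨ha, hah, va, ha1, ha2, ha3⟩ ⟨hb, hbh, vb, hb1, hb2, hb3⟩
    refine ⟨mul_mem ha hb, ?_, va ++ vb, ?_, ?_, ?_⟩
    · exact (congrArg a hbh).trans hah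
    · intro v hv
      rcases List.mem_append.1 hv with hv | hv
      · exact ha1 v hv
      · exact hb1 v hv
    · rw [extendReal_mul, ha2, hb2, List.map_append, List.prod_append]
    · rw [List.map_append, List.prod_append]
      exact mul_pos ha3 hb3
  inv_mem' := by
    rintro a ⟨ha, hah, va, ha1, ha2, ha3⟩
    refine ⟨inv_mem ha, ?_, va.reverse, ?_, ?_, ?_⟩
    · have h1 : a⁻¹ (a h) = h := a.symm_apply_apply h
      rwa [hah] at h1
    · intro v hv
      exact ha1 v (List.mem_reverse.1 hv)
    · have h1 : extendReal a⁻¹ * extendReal a = 1 := by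
        rw [← extendReal_mul, inv_mul_cancel, extendReal_one]
      have h2 := prod_reflection_mul_reverse va ha1
      rw [← ha2] at h2
      exact left_inv_eq_right_inv h1 h2
    · rw [List.map_reverse, List.prod_reverse]
      exact ha3

/-- `E` is a primitive totally isotropic sublattice of rank `2` of the lattice `h^⊥`. Such
sublattices correspond to the totally isotropic planes of `h^⊥ ⊗ ℚ` by `E ↦ E ⊗ ℚ`. -/
structure IsPrimitiveIsotropicPlane (h : L) (E : Submodule ℤ L) : Prop where
  le_perp : E ≤ perp h
  rank_eq_two : Module.finrank ℤ E = 2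
  isotropic : ∀ x ∈ E, ∀ y ∈ E, form x y = 0
  primitive : ∀ (m : ℤ) (x : L), m ≠ 0 → x ∈ perp h → m • x ∈ E → x ∈ E

/-- The set of primitive totally isotropic sublattices of rank `2` of `h^⊥`; they index the
one-dimensional rational boundary components of the period domain of `h^⊥`. -/
def IsotropicPlane (h : L) : Type := {E : Submodule ℤ L // IsPrimitiveIsotropicPlane h E}

theorem map_mem_perp {h : L} {g : L ≃ₗ[ℤ] L} (hg : g ∈ orthogonalPlus h) {x : L}
    (hx : x ∈ perp h) : g x ∈ perp h := by
  have h1 : form (g h) (g x) = form h x := hg.1 h x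
  rw [hg.2.1] at h1
  exact h1.trans hx

theorem IsPrimitiveIsotropicPlane.map {h : L} {g : L ≃ₗ[ℤ] L} (hg : g ∈ orthogonalPlus h)
    {E : Submodule ℤ L} (hE : IsPrimitiveIsotropicPlane h E) :
    IsPrimitiveIsotropicPlane h (E.map (g : L →ₗ[ℤ] L)) where
  le_perp := by
    rintro _ ⟨x, hx, rfl⟩
    exact map_mem_perp hg (hE.le_perp hx)
  rank_eq_two := (LinearEquiv.finrank_map_eq g E).trans hE.rank_eq_two
  isotropic := by
    rintro _ ⟨x, hx, rfl⟩ _ ⟨y, hy, rfl⟩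
    exact (hg.1 x y).trans (hE.isotropic x hx y hy)
  primitive := by
    rintro m x hm hx ⟨y, hy, hyx⟩
    refine ⟨g⁻¹ x, hE.primitive m _ hm (map_mem_perp (inv_mem hg) hx) ?_, g.apply_symm_apply x⟩
    have h1 : m • g⁻¹ x = y := by
      rw [← map_smul, ← hyx]
      exact g.symm_apply_apply y
    rw [h1]
    exact hy

/-- The action `E ↦ g(E)` of `O⁺(L, h)` on the sublattices. -/
noncomputable instance instMulActionIsotropicPlane (h : L) : MulAction (orthogonalPlus h) (IsotropicPlane h) where
  smul g E := ⟨E.1.map ((g : L ≃ₗ[ℤ] L) : L →ₗ[ℤ] L), E.2.map g.2⟩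
  one_smul E := Subtype.ext (Submodule.map_id E.1)
  mul_smul a b E := Subtype.ext (Submodule.map_comp
    ((b : L ≃ₗ[ℤ] L) : L →ₗ[ℤ] L) ((a : L ≃ₗ[ℤ] L) : L →ₗ[ℤ] L) E.1)

/-- The boundary curves of the orthogonal modular variety `𝓓_{h^⊥} / O⁺(L, h)`: the
`O⁺(L, h)`-orbits of primitive totally isotropic sublattices of rank `2` of `h^⊥`. -/
abbrev BoundaryCurve (h : L) : Type :=
  MulAction.orbitRel.Quotient (orthogonalPlus h) (IsotropicPlane h)

end KummerLattice

namespace KummerLattice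

/-! Write `e_i` for the basis vector `Pi.single i 1`, with `i` from 0 to 6. Every rank 2 isotropic
plane `E` of `h^⊥` can be moved, by an isometry `g` of spinor norm 1, onto the standard plane
spanned by `e_0` and `e_2` (`exists_single_mem`, `mem_iff`). Classifying the planes up to the
stabiliser of `h` thus becomes classifying the vectors `g h` up to the stabiliser of the standard
plane.

Orthogonality to the plane forces coordinates 1 and 3 of `g h` to vanish, so `v = g h` satisfies
`v_4 v_5 - 3 v_6² = p²`. Isometries fixing `e_0` and `e_2` reduce `v_0`, `v_2`, `v_6` modulo `v_5`
and achieve `|v_5| ≤ |v_4|` (`movesToReduced`). Then `v_5² ≤ p² + 3 v_6² ≤ p² + (3/4) v_5²`, so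
`|v_5| ≤ 2p`, and `v_4` is determined by the other coordinates. If `E` and `F` lead to the same
reduced vector, `g_E⁻¹ g_F` fixes `h` and carries `F` to `E`. Hence there are at most as many orbits
as reduced vectors, which is `O(p⁴)`.

The isometries used are Eichler transvections and reflections in vectors of norm -2, all of spinor
norm 1. -/

/-! ### Coordinates, half norm and the spinor kernel -/

theorem form_apply (x y : L) : form x y =
    x 0 * y 1 + x 1 * y 0 + x 2 * y 3 + x 3 * y 2 + x 4 * y 5 + x 5 * y 4 - 6 * (x 6 * y 6) := by
  simp [form, Matrix.toBilin'_apply, gram, Fin.sum_univ_succ]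
  ring

theorem realForm_apply (x y : LReal) : realForm x y =
    x 0 * y 1 + x 1 * y 0 + x 2 * y 3 + x 3 * y 2 + x 4 * y 5 + x 5 * y 4 - 6 * (x 6 * y 6) := by
  simp [realForm, Matrix.toBilin'_apply, gram, Fin.sum_univ_succ]
  ring

theorem form_comm (x y : L) : form x y = form y x := by
  rw [form_apply, form_apply]; ring

/-- The image of a lattice vector in `L ⊗ ℝ`. -/
def toReal (x : L) : LReal := fun i => (x i : ℝ)

theorem realForm_toReal (x y : L) : realForm (toReal x) (toReal y) = (form x y : ℝ) := by
  rw [form_apply, realForm_apply]; simp [toReal]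

theorem extendReal_eq {g : L ≃ₗ[ℤ] L} {T : Module.End ℝ LReal}
    (hT : ∀ x, T (toReal x) = toReal (g x)) : extendReal g = T := by
  refine (Pi.basisFun ℝ (Fin 7)).ext fun j => ?_
  have hj : (Pi.basisFun ℝ (Fin 7)) j = toReal (Pi.single j 1) := by
    funext i
    simp [toReal, Pi.single_apply]
  rw [hj, hT, extendReal, ← hj]
  funext i
  simp [toReal, LinearMap.toMatrix'_apply]

theorem reflection_apply (v x : LReal) :
    reflection v x = x - (2 / realForm v v * realForm v x) • v := by
  simp [reflection, smul_smul]

/-- The isometries of `L` of real spinor norm `1`. -/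
noncomputable def spinorKernel : Subgroup (L ≃ₗ[ℤ] L) where
  carrier := {g | g ∈ orthogonalGroup ∧ HasSpinorNormOne g}
  one_mem' := ⟨one_mem _, (one_mem (orthogonalPlus 0)).2.2⟩
  mul_mem' := by
    rintro a b ⟨ha, ha'⟩ ⟨hb, hb'⟩
    have := (orthogonalPlus 0).mul_mem ⟨ha, map_zero a, ha'⟩ ⟨hb, map_zero b, hb'⟩
    exact ⟨this.1, this.2.2⟩
  inv_mem' := by
    rintro a ⟨ha, ha'⟩
    have := (orthogonalPlus 0).inv_mem ⟨ha, map_zero a, ha'⟩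
    exact ⟨this.1, this.2.2⟩

theorem form_map {g : L ≃ₗ[ℤ] L} (hg : g ∈ spinorKernel) (x y : L) :
    form (g x) (g y) = form x y := hg.1 x y

/-- Half the norm of a lattice vector. -/
def quad (x : L) : ℤ := x 0 * x 1 + x 2 * x 3 + x 4 * x 5 - 3 * x 6 ^ 2

theorem form_self (x : L) : form x x = 2 * quad x := by
  rw [form_apply, quad]; ring

theorem quad_add (x y : L) : quad (x + y) = quad x + quad y + form x y := by
  simp only [form_apply, quad, Pi.add_apply]; ring

theorem quad_neg (x : L) : quad (-x) = quad x := by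
  simp only [quad, Pi.neg_apply]; ring

theorem quad_map {g : L ≃ₗ[ℤ] L} (hg : g ∈ spinorKernel) (x : L) : quad (g x) = quad x := by
  have := form_map hg x x
  rw [form_self, form_self] at this
  omega

/-! ### Eichler transvections and reflections in vectors of norm -2 -/

/-- The linear map underlying the Eichler transvection of an isotropic vector `e` and a vector
`a ∈ e^⊥`. -/
noncomputable def eichlerMap (e a : L) : L →ₗ[ℤ] L :=
  LinearMap.id - (form a).smulRight e + (form e).smulRight a - quad a • (form e).smulRight e

theorem eichlerMap_apply (e a x : L) :
    eichlerMap e a x = x - form a x • e + form e x • a - (quad a * form e x) • e := by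
  simp [eichlerMap, smul_smul, -zsmul_eq_mul]

theorem eichlerMap_eichlerMap {e a b : L} (he : form e e = 0) (ha : form e a = 0)
    (hb : form e b = 0) (x : L) :
    eichlerMap e a (eichlerMap e b x) = eichlerMap e (a + b) x := by
  have ha' : form a e = 0 := by rw [form_comm, ha]
  simp only [eichlerMap_apply, map_add, map_sub, map_smul, LinearMap.add_apply, he, ha', hb,
    quad_add, mul_zero]
  module

/-- The Eichler transvection of an isotropic vector `e` and a vector `a ∈ e^⊥`. -/
noncomputable def eichler (e a : L) (he : form e e = 0) (ha : form e a = 0) : L ≃ₗ[ℤ] L :=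
  LinearEquiv.ofLinearMap (eichlerMap e a) (eichlerMap e (-a))
    (LinearMap.ext fun x => by
      rw [LinearMap.comp_apply, eichlerMap_eichlerMap he ha (by rw [map_neg, ha, neg_zero])]
      simp [eichlerMap_apply, quad])
    (LinearMap.ext fun x => by
      rw [LinearMap.comp_apply, eichlerMap_eichlerMap he (by rw [map_neg, ha, neg_zero]) ha]
      simp [eichlerMap_apply, quad])

theorem eichler_apply {e a : L} (he : form e e = 0) (ha : form e a = 0) (x : L) :
    eichler e a he ha x = x - form a x • e + form e x • a - (quad a * form e x) • e :=
  eichlerMap_apply e a x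

theorem eichler_mul {e a b : L} (he : form e e = 0) (ha : form e a = 0) (hb : form e b = 0) :
    eichler e a he ha * eichler e b he hb
      = eichler e (a + b) he (by rw [map_add, ha, hb, add_zero]) :=
  LinearEquiv.ext fun x => eichlerMap_eichlerMap he ha hb x

theorem eichler_mem_orthogonalGroup {e a : L} (he : form e e = 0) (ha : form e a = 0) :
    eichler e a he ha ∈ orthogonalGroup := by
  intro x y
  have ha' : form a e = 0 := by rw [form_comm, ha]
  simp only [eichler_apply, map_add, map_sub, map_smul, LinearMap.add_apply, LinearMap.sub_apply,
    LinearMap.smul_apply, he, ha, ha', form_self a, form_comm x e, form_comm x a, smul_eq_mul]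
  ring

/-- The transvection is the product of the reflections in `a` and `a + quad a • e`. Both have norm
`2 * quad a`, so the product of the signs is positive. -/
theorem eichler_mem_of_quad_ne_zero {e a : L} (he : form e e = 0) (ha : form e a = 0)
    (hq : quad a ≠ 0) : eichler e a he ha ∈ spinorKernel := by
  refine ⟨eichler_mem_orthogonalGroup he ha, [toReal a, toReal (a + quad a • e)], ?_, ?_, ?_⟩
  all_goals
    have ha' : form a e = 0 := by rw [form_comm, ha]
    have hn : form (a + quad a • e) (a + quad a • e) = 2 * quad a := by
      simp [he, ha, ha', form_self a, -zsmul_eq_mul]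
    have hq' : (quad a : ℝ) ≠ 0 := by exact_mod_cast hq
  · simp only [List.mem_cons, List.not_mem_nil, or_false, forall_eq_or_imp, forall_eq,
      realForm_toReal, form_self a, hn]
    push_cast
    simp [hq']
  · refine extendReal_eq fun x => ?_
    simp only [List.map_cons, List.map_nil, List.prod_cons, List.prod_nil, mul_one,
      Module.End.mul_apply, reflection_apply, map_sub, map_smul, realForm_toReal, form_self a, hn]
    have h1 : form a (a + quad a • e) = 2 * quad a := by
      simp [ha', form_self a, -zsmul_eq_mul]
    simp only [h1, eichler_apply, map_add, map_smul, LinearMap.add_apply, LinearMap.smul_apply]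
    funext i
    simp [toReal]
    field_simp
    ring
  · simp only [List.map_cons, List.map_nil, List.prod_cons, List.prod_nil, mul_one,
      realForm_toReal, form_self a, hn]
    push_cast
    nlinarith [mul_self_pos.2 hq']

/-- Transvections along the same `e` are additive in `a`, so an isotropic `a` can be written as `(a
+ b) + (-b)` with both parts anisotropic. The condition `e 6 = 0` makes `b = ± e_6` orthogonal to
`e`. -/
theorem eichler_mem {e a : L} (he : form e e = 0) (ha : form e a = 0) (h6 : e 6 = 0) :
    eichler e a he ha ∈ spinorKernel := by
  by_cases hq : quad a = 0
  · obtain ⟨b, hb, hqb, hab⟩ : ∃ b : L, form e b = 0 ∧ quad b ≠ 0 ∧ quad (a + b) ≠ 0 := by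
      by_cases h : form a (Pi.single 6 1) = 3
      · refine ⟨Pi.single 6 (-1), ?_, ?_, ?_⟩
        · simp [form_apply, h6]
        · simp [quad]
        · rw [show (Pi.single 6 (-1) : L) = - Pi.single 6 1 from Pi.single_neg 6 1, quad_add, hq, quad_neg,
            map_neg, h]
          simp [quad]
      · refine ⟨Pi.single 6 1, ?_, ?_, ?_⟩
        · simp [form_apply, h6]
        · simp [quad]
        · rw [quad_add, hq]
          simp only [quad, ne_eq]
          simp
          omega
    have hb' : form e (-b) = 0 := by rw [map_neg, hb, neg_zero]
    have hab' : form e (a + b) = 0 := by rw [map_add, ha, hb, add_zero]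
    have h := mul_mem (eichler_mem_of_quad_ne_zero he hab' hab)
      (eichler_mem_of_quad_ne_zero he hb' (by rwa [quad_neg]))
    rw [eichler_mul] at h
    simpa only [add_neg_cancel_right] using h
  · exact eichler_mem_of_quad_ne_zero he ha hq

/-- The reflection in a vector `r` of norm `-2`, as an isometry of `L`. -/
noncomputable def rootReflection (r : L) (hr : form r r = -2) : L ≃ₗ[ℤ] L :=
  LinearEquiv.ofInvolutive (LinearMap.id + (form r).smulRight r) fun x => by
    simp only [LinearMap.add_apply, LinearMap.id_apply, LinearMap.smulRight_apply, map_add,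
      map_smul, hr]
    module

theorem rootReflection_apply {r : L} (hr : form r r = -2) (x : L) :
    rootReflection r hr x = x + form r x • r := rfl

theorem rootReflection_mem {r : L} (hr : form r r = -2) :
    rootReflection r hr ∈ spinorKernel := by
  refine ⟨fun x y => ?_, [toReal r], ?_, ?_, ?_⟩
  · simp only [rootReflection_apply, map_add, map_smul, LinearMap.add_apply, LinearMap.smul_apply,
      hr, form_comm x r, smul_eq_mul]
    ring
  · simp [realForm_toReal, hr]
  · refine extendReal_eq fun x => ?_
    simp only [List.map_cons, List.map_nil, List.prod_cons, List.prod_nil, mul_one,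
      reflection_apply, realForm_toReal, hr, rootReflection_apply]
    funext i
    simp [toReal]
  · simp [realForm_toReal, hr]

/-! ### Primitive vectors and centred residues -/

theorem IsPrimitive.map {v : L} (hv : IsPrimitive v) (g : L ≃ₗ[ℤ] L) : IsPrimitive (g v) := by
  refine ⟨fun h => hv.1 (by simpa using h), fun m x h => hv.2 m (g.symm x) ?_⟩
  rw [← map_smul, ← h, g.symm_apply_apply]

theorem exists_isPrimitive_smul {x : L} (hx : x ≠ 0) :
    ∃ (d : ℤ) (v : L), d ≠ 0 ∧ IsPrimitive v ∧ x = d • v := by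
  obtain ⟨v, hv, hv1⟩ := Finset.extract_gcd x (Finset.univ_nonempty (α := Fin 7))
  have hxv : x = Finset.univ.gcd x • v := by
    funext i
    exact hv i (Finset.mem_univ i)
  refine ⟨Finset.univ.gcd x, v, fun h => hx (by rw [hxv, h, zero_smul]), ⟨?_, ?_⟩, hxv⟩
  · rintro rfl
    exact hx (by rw [hxv, smul_zero])
  · rintro m y rfl
    refine isUnit_of_dvd_one (hv1 ▸ Finset.dvd_gcd fun i _ => ?_)
    exact ⟨y i, rfl⟩

/-- A centred residue `c` satisfies `3 c² ≤ (3/4) m² < m²`. This beats the coefficient 3 of `quad`,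
both in the descent for isotropic vectors and in the bound on reduced vectors. -/
theorem exists_two_mul_abs_add_mul_le (c : ℤ) {m : ℤ} (hm : m ≠ 0) :
    ∃ k : ℤ, 2 * |c + k * m| ≤ |m| := by
  have h1 := Int.emod_nonneg c hm
  have h2 := Int.emod_lt_abs c hm
  have h3 := Int.emod_add_mul_ediv c m
  by_cases h : 2 * (c % m) ≤ |m|
  · refine ⟨-(c / m), ?_⟩
    rw [show c + -(c / m) * m = c % m by linarith [mul_comm m (c / m)], abs_of_nonneg h1]
    exact h
  · refine ⟨-(c / m) - SignType.sign m, ?_⟩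
    have h4 : (SignType.sign m : ℤ) * m = |m| := sign_mul_self m
    rw [show c + (-(c / m) - SignType.sign m) * m = c % m - |m| by
      linarith [mul_comm m (c / m)], abs_of_nonpos (by linarith)]
    linarith

/-! ### Elementary moves on coordinates -/

theorem exists_swap_two (v : L) : ∃ g ∈ spinorKernel, g (Pi.single 0 1) = Pi.single 0 1 ∧
    g v = ![v 0, v 1, v 3, v 2, v 4, v 5, v 6] := by
  have hr : form (Pi.single 2 1 - Pi.single 3 1) (Pi.single 2 1 - Pi.single 3 1) = -2 := by
    simp [form_apply]
  refine ⟨_, rootReflection_mem hr, ?_, ?_⟩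
  · simp [rootReflection_apply, form_apply]
  · rw [rootReflection_apply]
    funext i
    fin_cases i <;> simp [form_apply]

theorem exists_swap_four (v : L) : ∃ g ∈ spinorKernel, g (Pi.single 0 1) = Pi.single 0 1 ∧
    g (Pi.single 2 1) = Pi.single 2 1 ∧ g v = ![v 0, v 1, v 2, v 3, v 5, v 4, v 6] := by
  have hr : form (Pi.single 4 1 - Pi.single 5 1) (Pi.single 4 1 - Pi.single 5 1) = -2 := by
    simp [form_apply]
  refine ⟨_, rootReflection_mem hr, ?_, ?_, ?_⟩
  · simp [rootReflection_apply, form_apply]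
  · simp [rootReflection_apply, form_apply]
  · rw [rootReflection_apply]
    funext i
    fin_cases i <;> simp [form_apply]

/-- As `(e_2, v) = v_3`, transvections along `e_2` add multiples of `v_3` to the other coordinates;
coordinate 2 absorbs the correction. -/
theorem exists_transvection_two (v : L) (a b c d k : ℤ) : ∃ g ∈ spinorKernel,
    (a = 0 → b = 0 → g (Pi.single 0 1) = Pi.single 0 1) ∧ ∃ t,
    g v = ![v 0 + a * v 3, v 1 + b * v 3, t, v 3, v 4 + c * v 3, v 5 + d * v 3, v 6 + k * v 3] := by
  have he : form (Pi.single 2 1) (Pi.single 2 1) = 0 := by simp [form_apply]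
  have ha : form (Pi.single 2 1) ![a, b, 0, 0, c, d, k] = 0 := by simp [form_apply]
  refine ⟨_, eichler_mem he ha (by simp), ?_,
    v 2 - form ![a, b, 0, 0, c, d, k] v - quad ![a, b, 0, 0, c, d, k] * v 3, ?_⟩
  · rintro rfl rfl
    simp [eichler_apply, form_apply]
  · rw [eichler_apply]
    funext i
    simp only [Pi.add_apply, Pi.sub_apply, Pi.smul_apply, smul_eq_mul]
    fin_cases i <;> simp [form_apply, mul_comm]

/-- The condition `hq` makes the parameter vector isotropic, which removes the quadratic term from
coordinate 3. -/
theorem exists_transvection_three (v : L) (a b c d : ℤ) (hq : a * b + c * d = 0) :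
    ∃ g ∈ spinorKernel, (a = 0 → b = 0 → g (Pi.single 0 1) = Pi.single 0 1) ∧
    g v = ![v 0 + a * v 2, v 1 + b * v 2, v 2, v 3 - (a * v 1 + b * v 0 + c * v 5 + d * v 4),
      v 4 + c * v 2, v 5 + d * v 2, v 6] := by
  have he : form (Pi.single 3 1) (Pi.single 3 1) = 0 := by simp [form_apply]
  have ha : form (Pi.single 3 1) ![a, b, 0, 0, c, d, 0] = 0 := by simp [form_apply]
  have hq' : quad ![a, b, 0, 0, c, d, 0] = 0 := by simp [quad, hq]
  refine ⟨_, eichler_mem he ha (by simp), ?_, ?_⟩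
  · rintro rfl rfl
    simp [eichler_apply, form_apply]
  · rw [eichler_apply, hq']
    funext i
    simp only [Pi.add_apply, Pi.sub_apply, Pi.smul_apply, smul_eq_mul]
    fin_cases i <;> simp [form_apply, mul_comm]

/-! ### Descent for primitive isotropic vectors -/

/-- `v` can be moved to `±e₂`, and if `v` has no component in the first hyperbolic plane, then
this can be done by an isometry that fixes the first basis vector. -/
def MovesToTwo (v : L) : Prop :=
  ∃ g ∈ spinorKernel, (v 0 = 0 → v 1 = 0 → g (Pi.single 0 1) = Pi.single 0 1) ∧
    (g v = Pi.single 2 1 ∨ g v = -Pi.single 2 1)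

theorem MovesToTwo.of_map {v : L} {g : L ≃ₗ[ℤ] L} (hg : g ∈ spinorKernel)
    (hfix : v 0 = 0 → v 1 = 0 → g (Pi.single 0 1) = Pi.single 0 1 ∧ g v 0 = 0 ∧ g v 1 = 0)
    (h : MovesToTwo (g v)) : MovesToTwo v := by
  obtain ⟨k, hk, hk0, hkv⟩ := h
  refine ⟨k * g, mul_mem hk hg, fun h0 h1 => ?_, hkv⟩
  obtain ⟨h2, h3, h4⟩ := hfix h0 h1
  rw [LinearEquiv.mul_apply, h2, hk0 h3 h4]

/-- Euclidean descent on `|v_3|`. Reduce the other coordinates, except `v_2`, modulo `v_3`. A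
nonzero residue among coordinates 0, 1, 4, 5 yields a smaller nonzero `v_3` by a transvection along
`e_3`. If all four vanish, isotropy makes `v_2` smaller than `v_3`, and the two are swapped. -/
theorem movesToTwo_of_ne_zero (n : ℕ) : ∀ v : L, IsPrimitive v → quad v = 0 → v 3 ≠ 0 →
    (v 3).natAbs = n → MovesToTwo v := by
  induction n using Nat.strong_induction_on with
  | _ n ih =>
  intro v hv hq h3 hn
  obtain ⟨k, hk⟩ := exists_two_mul_abs_add_mul_le (v 6) h3
  obtain ⟨g, hg, hg0, t, hgv⟩ := exists_transvection_two v (-(v 0 / v 3)) (-(v 1 / v 3))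
    (-(v 4 / v 3)) (-(v 5 / v 3)) k
  have hmod : ∀ x, x + -(x / v 3) * v 3 = x % v 3 := fun x => by
    linarith [Int.emod_add_mul_ediv x (v 3), mul_comm (v 3) (x / v 3)]
  refine MovesToTwo.of_map hg (fun h0 h1 => ⟨hg0 (by simp [h0]) (by simp [h1]), ?_, ?_⟩) ?_
  · simp [hgv, h0]
  · simp [hgv, h1]
  have hw := hv.map g
  have hwq : quad (g v) = 0 := by rw [quad_map hg, hq]
  rw [hmod, hmod, hmod, hmod] at hgv
  generalize g v = w at *
  have hlt : ∀ x, 0 ≤ x % v 3 ∧ x % v 3 < |v 3| := fun x =>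
    ⟨Int.emod_nonneg x h3, Int.emod_lt_abs x h3⟩
  have key : ∀ a b c d : ℤ, a * b + c * d = 0 → (w 0 = 0 → w 1 = 0 → a = 0 ∧ b = 0) →
      w 3 - (a * w 1 + b * w 0 + c * w 5 + d * w 4) ≠ 0 →
      |w 3 - (a * w 1 + b * w 0 + c * w 5 + d * w 4)| < |v 3| → MovesToTwo w := by
    intro a b c d habcd hab hne hlt
    obtain ⟨g', hg', hg'0, hg'w⟩ := exists_transvection_three w a b c d habcd
    refine MovesToTwo.of_map hg' (fun h0 h1 => ?_) (ih _ ?_ _ (hw.map g')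
      (by rw [quad_map hg', hwq]) ?_ rfl)
    · obtain ⟨ha, hb⟩ := hab h0 h1
      exact ⟨hg'0 ha hb, by simp [hg'w, ha, h0], by simp [hg'w, hb, h1]⟩
    · rw [← hn, ← Int.ofNat_lt, Int.natCast_natAbs, Int.natCast_natAbs, hg'w]
      simpa using hlt
    · simp only [hg'w]
      simpa using hne
  -- The sign is chosen so that the new coordinate has absolute value `|v 3| - x % v 3`, strictly
  -- between 0 and `|v 3|`.
  have hfin : ∀ x, x % v 3 ≠ 0 → v 3 - SignType.sign (v 3) * (x % v 3) ≠ 0 ∧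
      |v 3 - SignType.sign (v 3) * (x % v 3)| < |v 3| := by
    intro x hx
    have := hlt x
    rcases lt_or_gt_of_ne h3 with h | h
    · rw [sign_neg h]; simp; grind
    · rw [sign_pos h]; simp; grind
  by_cases h0 : v 0 % v 3 = 0; swap
  · refine key 0 (SignType.sign (v 3)) 0 0 (by ring) ?_ ?_ ?_
    · intro h; simp [hgv] at h; omega
    · simpa [hgv] using (hfin _ h0).1
    · simpa [hgv] using (hfin _ h0).2
  by_cases h1 : v 1 % v 3 = 0; swap
  · refine key (SignType.sign (v 3)) 0 0 0 (by ring) ?_ ?_ ?_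
    · intro _ h; simp [hgv] at h; omega
    · simpa [hgv] using (hfin _ h1).1
    · simpa [hgv] using (hfin _ h1).2
  by_cases h4 : v 4 % v 3 = 0; swap
  · refine key 0 0 0 (SignType.sign (v 3)) (by ring) (fun _ _ => ⟨rfl, rfl⟩) ?_ ?_
    · simpa [hgv] using (hfin _ h4).1
    · simpa [hgv] using (hfin _ h4).2
  by_cases h5 : v 5 % v 3 = 0; swap
  · refine key 0 0 (SignType.sign (v 3)) 0 (by ring) (fun _ _ => ⟨rfl, rfl⟩) ?_ ?_
    · simpa [hgv] using (hfin _ h5).1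
    · simpa [hgv] using (hfin _ h5).2
  rw [h0, h1, h4, h5] at hgv
  have hnorm : t * v 3 = 3 * (v 6 + k * v 3) ^ 2 := by
    simp [hgv, quad] at hwq
    linarith
  obtain ⟨g', hg', hg'0, hg'w⟩ := exists_swap_two w
  refine MovesToTwo.of_map hg' (fun h0 h1 => ⟨hg'0, by simp [hg'w, h0], by simp [hg'w, h1]⟩) ?_
  -- If `t = 0`, then `w` is a multiple of `e_3`, and primitivity makes the factor a unit. Otherwise
  -- `|t| |v 3| = 3 c² ≤ (3/4) |v 3|²`, where `c` is coordinate 6, so `|t| < |v 3|`.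
  by_cases ht : t = 0
  · have hc : v 6 + k * v 3 = 0 := by
      rw [ht, zero_mul] at hnorm
      simpa using hnorm.symm
    have hwe : g' w = v 3 • Pi.single 2 1 := by
      rw [hg'w]
      funext i
      fin_cases i <;> simp [hgv, ht, hc]
    refine ⟨1, one_mem _, fun _ _ => rfl, ?_⟩
    rcases Int.isUnit_iff.1 ((hw.map g').2 _ _ hwe) with h | h
    · exact Or.inl (by rw [LinearEquiv.coe_one, id, hwe, h, one_smul])
    · exact Or.inr (by rw [LinearEquiv.coe_one, id, hwe, h, neg_smul, one_smul])
  · have e : (g' w) 3 = t := by rw [hg'w]; simp [hgv]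
    refine ih _ ?_ _ (hw.map g') (by rw [quad_map hg', hwq]) (by rwa [e]) rfl
    rw [e, ← hn, ← Int.ofNat_lt, Int.natCast_natAbs, Int.natCast_natAbs]
    have h7 : |t| * |v 3| = 3 * |v 6 + k * v 3| ^ 2 := by
      rw [← abs_mul, hnorm, abs_mul, abs_pow]; rfl
    have h8 := abs_pos.2 h3
    have h9 := abs_nonneg (v 6 + k * v 3)
    by_contra hcon
    nlinarith

theorem movesToTwo {v : L} (hv : IsPrimitive v) (hq : quad v = 0) : MovesToTwo v := by
  by_cases h3 : v 3 = 0; swap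
  · exact movesToTwo_of_ne_zero _ v hv hq h3 rfl
  by_cases h2 : v 2 = 0; swap
  · obtain ⟨g, hg, hg0, hgv⟩ := exists_swap_two v
    refine MovesToTwo.of_map hg (fun h0 h1 => ⟨hg0, by simp [hgv, h0], by simp [hgv, h1]⟩)
      (movesToTwo_of_ne_zero _ _ (hv.map g) (by rw [quad_map hg, hq]) ?_ rfl)
    simpa [hgv] using h2
  -- Since `v 2 = v 3 = 0`, a transvection along `e_3` changes only coordinate 3, so any nonzero
  -- value there gives access to the descent.
  have key : ∀ a b c d : ℤ, a * b + c * d = 0 → (v 0 = 0 → v 1 = 0 → a = 0 ∧ b = 0) →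
      a * v 1 + b * v 0 + c * v 5 + d * v 4 ≠ 0 → MovesToTwo v := by
    intro a b c d habcd hab hne
    obtain ⟨g, hg, hg0, hgv⟩ := exists_transvection_three v a b c d habcd
    refine MovesToTwo.of_map hg (fun h0 h1 => ?_)
      (movesToTwo_of_ne_zero _ _ (hv.map g) (by rw [quad_map hg, hq]) ?_ rfl)
    · obtain ⟨ha, hb⟩ := hab h0 h1
      exact ⟨hg0 ha hb, by simp [hgv, ha, h0], by simp [hgv, hb, h1]⟩
    · simp only [hgv]
      simp [h3]
      omega
  by_cases h0 : v 0 = 0; swap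
  · exact key 0 1 0 0 (by ring) (fun h => absurd h h0) (by simpa using h0)
  by_cases h1 : v 1 = 0; swap
  · exact key 1 0 0 0 (by ring) (fun _ h => absurd h h1) (by simpa using h1)
  by_cases h4 : v 4 = 0; swap
  · exact key 0 0 0 1 (by ring) (fun _ _ => ⟨rfl, rfl⟩) (by simpa using h4)
  by_cases h5 : v 5 = 0; swap
  · exact key 0 0 1 0 (by ring) (fun _ _ => ⟨rfl, rfl⟩) (by simpa using h5)
  have h6 : v 6 = 0 := by simpa [quad, h0, h2, h4] using hq
  refine absurd ?_ hv.1
  funext i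
  fin_cases i <;> assumption

theorem exists_map_eq_single_zero {v : L} (hv : IsPrimitive v) (hq : quad v = 0) :
    ∃ g ∈ spinorKernel, g v = Pi.single 0 1 ∨ g v = -Pi.single 0 1 := by
  obtain ⟨g, hg, -, hgv⟩ := movesToTwo hv hq
  have he : form (Pi.single 0 1) (Pi.single 0 1) = 0 := by simp [form_apply]
  have ha : form (Pi.single 0 1) (-Pi.single 3 1) = 0 := by simp [form_apply]
  have he' : form (Pi.single 2 1) (Pi.single 2 1) = 0 := by simp [form_apply]
  have ha' : form (Pi.single 2 1) (Pi.single 1 1) = 0 := by simp [form_apply]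
  -- The two transvections send `e_2` to `e_0 + e_2` and then to `e_0`.
  have h : eichler _ _ he' ha' (eichler _ _ he ha (Pi.single 2 1)) = Pi.single 0 1 := by
    simp [eichler_apply, form_apply]
  refine ⟨eichler _ _ he' ha' * (eichler _ _ he ha * g),
    mul_mem (eichler_mem _ _ (by simp)) (mul_mem (eichler_mem _ _ (by simp)) hg), ?_⟩
  simp only [LinearEquiv.mul_apply]
  rcases hgv with hgv | hgv
  · exact Or.inl (by rw [hgv, h])
  · exact Or.inr (by rw [hgv, map_neg, map_neg, h])

/-! ### Moving isotropic planes to the standard plane -/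

theorem exists_mem_eq_single_zero {E : Submodule ℤ L} (hne : E ≠ ⊥)
    (hiso : ∀ x ∈ E, quad x = 0) (hsat : ∀ (m : ℤ) (x : L), m ≠ 0 → m • x ∈ E → x ∈ E) :
    ∃ g ∈ spinorKernel, ∃ x ∈ E, g x = Pi.single 0 1 := by
  obtain ⟨x, hx, hx0⟩ := (Submodule.ne_bot_iff E).1 hne
  obtain ⟨d, v, hd, hv, rfl⟩ := exists_isPrimitive_smul hx0
  have hvE := hsat d v hd hx
  obtain ⟨g, hg, h | h⟩ := exists_map_eq_single_zero hv (hiso v hvE)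
  · exact ⟨g, hg, v, hvE, h⟩
  · exact ⟨g, hg, -v, neg_mem hvE, by rw [map_neg, h, neg_neg]⟩

/-- `E` is a totally isotropic sublattice of rank `2` that is saturated in `L`. -/
structure IsSaturatedIsotropicPlane (E : Submodule ℤ L) : Prop where
  finrank_eq : Module.finrank ℤ E = 2
  isotropic : ∀ x ∈ E, ∀ y ∈ E, form x y = 0
  saturated : ∀ (m : ℤ) (x : L), m ≠ 0 → m • x ∈ E → x ∈ E

theorem IsPrimitiveIsotropicPlane.isSaturatedIsotropicPlane {h : L} {E : Submodule ℤ L}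
    (hE : IsPrimitiveIsotropicPlane h E) : IsSaturatedIsotropicPlane E where
  finrank_eq := hE.rank_eq_two
  isotropic := hE.isotropic
  saturated m x hm hx := by
    refine hE.primitive m x hm ?_ hx
    have := hE.le_perp hx
    rw [perp, LinearMap.mem_ker, map_smul, smul_eq_mul] at this
    -- `h^⊥` is itself saturated in `L`.
    exact (mul_eq_zero.1 this).resolve_left hm

namespace IsSaturatedIsotropicPlane

variable {E : Submodule ℤ L}

theorem quad_eq_zero (hE : IsSaturatedIsotropicPlane E) {x : L} (hx : x ∈ E) : quad x = 0 := by
  have := hE.isotropic x hx x hx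
  rw [form_self] at this
  omega

theorem map (hE : IsSaturatedIsotropicPlane E) {g : L ≃ₗ[ℤ] L} (hg : g ∈ spinorKernel) :
    IsSaturatedIsotropicPlane (E.map (g : L →ₗ[ℤ] L)) where
  finrank_eq := (LinearEquiv.finrank_map_eq g E).trans hE.finrank_eq
  isotropic := by
    rintro _ ⟨x, hx, rfl⟩ _ ⟨y, hy, rfl⟩
    exact (form_map hg x y).trans (hE.isotropic x hx y hy)
  saturated := by
    rintro m x hm ⟨y, hy, hyx⟩
    refine ⟨g.symm x, hE.saturated m _ hm ?_, g.apply_symm_apply x⟩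
    rw [← map_smul, ← hyx]
    simpa using hy

theorem exists_single_mem (hE : IsSaturatedIsotropicPlane E) :
    ∃ g ∈ spinorKernel, Pi.single 0 1 ∈ E.map (g : L →ₗ[ℤ] L) ∧
      Pi.single 2 1 ∈ E.map (g : L →ₗ[ℤ] L) := by
  have hne : E ≠ ⊥ := by
    rintro rfl
    simpa using hE.finrank_eq
  obtain ⟨g, hg, x, hx, hgx⟩ :=
    exists_mem_eq_single_zero hne (fun _ => hE.quad_eq_zero) hE.saturated
  have hF := hE.map hg
  have h0 : Pi.single 0 1 ∈ E.map (g : L →ₗ[ℤ] L) := ⟨x, hx, hgx⟩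
  -- Isotropy gives `y 1 = 0`, and subtracting a multiple of `e_0` gives `y 0 = 0`. The vector then
  -- lies in the complement of the first hyperbolic plane, where it can be moved to `± e_2` with
  -- `e_0` fixed.
  obtain ⟨y, hy, hy1, hy0, hyne⟩ :
      ∃ y ∈ E.map (g : L →ₗ[ℤ] L), y 1 = 0 ∧ y 0 = 0 ∧ y ≠ 0 := by
    by_contra! hcon
    have : Module.finrank ℤ (E.map (g : L →ₗ[ℤ] L)) ≤ 1 := by
      refine finrank_le_one ⟨Pi.single 0 1, h0⟩ fun ⟨y, hy⟩ => ⟨y 0, Subtype.ext ?_⟩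
      have h1 : y 1 = 0 := by simpa [form_apply] using hF.isotropic _ h0 _ hy
      have := hcon (y - y 0 • Pi.single 0 1) (sub_mem hy (E.map _ |>.smul_mem _ h0))
        (by simp [h1]) (by simp)
      exact (sub_eq_zero.1 this).symm
    rw [hF.finrank_eq] at this
    omega
  obtain ⟨d, v, hd, hv, rfl⟩ := exists_isPrimitive_smul hyne
  have hvF := hF.saturated d v hd hy
  obtain ⟨k, hk, hk0, hkv⟩ := movesToTwo hv (hF.quad_eq_zero hvF)
  have hk0 := hk0 (by simpa [hd] using hy0) (by simpa [hd] using hy1)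
  refine ⟨k * g, mul_mem hk hg, ?_⟩
  have hmap : E.map ((k * g : L ≃ₗ[ℤ] L) : L →ₗ[ℤ] L)
      = (E.map (g : L →ₗ[ℤ] L)).map (k : L →ₗ[ℤ] L) :=
    Submodule.map_comp (g : L →ₗ[ℤ] L) (k : L →ₗ[ℤ] L) E
  rw [hmap]
  refine ⟨⟨_, h0, hk0⟩, ?_⟩
  rcases hkv with h | h
  · exact ⟨v, hvF, h⟩
  · exact ⟨-v, neg_mem hvF, by rw [map_neg]; exact neg_eq_iff_eq_neg.2 h⟩

theorem mem_iff (hE : IsSaturatedIsotropicPlane E) (h0 : Pi.single 0 1 ∈ E)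
    (h2 : Pi.single 2 1 ∈ E) (x : L) :
    x ∈ E ↔ x 1 = 0 ∧ x 3 = 0 ∧ x 4 = 0 ∧ x 5 = 0 ∧ x 6 = 0 := by
  constructor
  · intro hx
    have h1 : x 1 = 0 := by simpa [form_apply] using hE.isotropic _ h0 _ hx
    have h3 : x 3 = 0 := by simpa [form_apply] using hE.isotropic _ h2 _ hx
    refine ⟨h1, h3, ?_⟩
    by_contra hcon
    -- A nonzero coordinate 4, 5 or 6 would produce three independent vectors in a module of rank 2.
    have hli : LinearIndependent ℤ ![(⟨Pi.single 0 1, h0⟩ : E), ⟨Pi.single 2 1, h2⟩, ⟨x, hx⟩] := by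
      rw [Fintype.linearIndependent_iff]
      intro c hsum
      have hsum' : c 0 • (Pi.single 0 1 : L) + c 1 • (Pi.single 2 1 : L) + c 2 • x = 0 := by
        simpa [Fin.sum_univ_three, -zsmul_eq_mul] using congrArg Subtype.val hsum
      have hi : ∀ i, c 0 * (Pi.single 0 1 : L) i + c 1 * (Pi.single 2 1 : L) i + c 2 * x i = 0 :=
        fun i => congrFun hsum' i
      have c2 : c 2 = 0 := by
        by_contra hc2
        exact hcon ⟨by simpa [hc2] using hi 4, by simpa [hc2] using hi 5,
          by simpa [hc2] using hi 6⟩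
      have c0 : c 0 = 0 := by simpa [c2] using hi 0
      have c1 : c 1 = 0 := by simpa [c2] using hi 2
      intro i
      fin_cases i
      exacts [c0, c1, c2]
    have := hli.fintype_card_le_finrank
    rw [hE.finrank_eq] at this
    simp at this
  · rintro ⟨h1, h3, h4, h5, h6⟩
    have : x = x 0 • Pi.single 0 1 + x 2 • Pi.single 2 1 := by
      funext i
      fin_cases i <;> simp [h1, h3, h4, h5, h6]
    rw [this]
    exact add_mem (E.smul_mem _ h0) (E.smul_mem _ h2)

end IsSaturatedIsotropicPlane

/-! ### Reducing the polarisation while fixing `e_0` and `e_2` -/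

theorem exists_transvection_four (v : L) (k : ℤ) : ∃ g ∈ spinorKernel,
    g (Pi.single 0 1) = Pi.single 0 1 ∧ g (Pi.single 2 1) = Pi.single 2 1 ∧ ∃ t,
    g v = ![v 0, v 1, v 2, v 3, t, v 5, v 6 + k * v 5] := by
  have he : form (Pi.single 4 1) (Pi.single 4 1) = 0 := by simp [form_apply]
  have ha : form (Pi.single 4 1) ![0, 0, 0, 0, 0, 0, k] = 0 := by simp [form_apply]
  refine ⟨_, eichler_mem he ha (by simp), ?_, ?_,
    v 4 - form ![0, 0, 0, 0, 0, 0, k] v - quad ![0, 0, 0, 0, 0, 0, k] * v 5, ?_⟩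
  · simp [eichler_apply, form_apply]
  · simp [eichler_apply, form_apply]
  · rw [eichler_apply]
    funext i
    simp only [Pi.add_apply, Pi.sub_apply, Pi.smul_apply, smul_eq_mul]
    fin_cases i <;> simp [form_apply, mul_comm]

theorem exists_shift (v : L) (h1 : v 1 = 0) (h3 : v 3 = 0) (a b : ℤ) : ∃ g ∈ spinorKernel,
    g (Pi.single 0 1) = Pi.single 0 1 ∧ g (Pi.single 2 1) = Pi.single 2 1 ∧
    g v = ![v 0 + a * v 5, 0, v 2 + b * v 5, 0, v 4, v 5, v 6] := by
  have he : form (Pi.single 0 1) (Pi.single 0 1) = 0 := by simp [form_apply]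
  have ha : form (Pi.single 0 1) (Pi.single 4 (-a)) = 0 := by simp [form_apply]
  have he' : form (Pi.single 2 1) (Pi.single 2 1) = 0 := by simp [form_apply]
  have ha' : form (Pi.single 2 1) (Pi.single 4 (-b)) = 0 := by simp [form_apply]
  refine ⟨_, mul_mem (eichler_mem he ha (by simp)) (eichler_mem he' ha' (by simp)), ?_, ?_, ?_⟩
  · simp [eichler_apply, form_apply]
  · simp [eichler_apply, form_apply]
  · funext i
    simp only [LinearEquiv.mul_apply, eichler_apply, Pi.add_apply, Pi.sub_apply, Pi.smul_apply,
      smul_eq_mul]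
    fin_cases i <;> simp [form_apply, h1, h3]

/-- Some isometry of spinor norm `1` that fixes the first basis vectors of the first two
hyperbolic planes moves `v` to a vector with reduced coordinates. -/
def MovesToReduced (v : L) : Prop :=
  ∃ g ∈ spinorKernel, g (Pi.single 0 1) = Pi.single 0 1 ∧ g (Pi.single 2 1) = Pi.single 2 1 ∧
    g v 0 ∈ Set.Ico 0 |g v 5| ∧ g v 2 ∈ Set.Ico 0 |g v 5| ∧ 2 * |g v 6| ≤ |g v 5| ∧
    |g v 5| ≤ |g v 4|

theorem MovesToReduced.of_map {v : L} {g : L ≃ₗ[ℤ] L} (hg : g ∈ spinorKernel)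
    (h0 : g (Pi.single 0 1) = Pi.single 0 1) (h2 : g (Pi.single 2 1) = Pi.single 2 1)
    (h : MovesToReduced (g v)) : MovesToReduced v := by
  obtain ⟨k, hk, hk0, hk2, hkv⟩ := h
  refine ⟨k * g, mul_mem hk hg, ?_, ?_, hkv⟩
  · rw [LinearEquiv.mul_apply, h0, hk0]
  · rw [LinearEquiv.mul_apply, h2, hk2]

/-- Descent on `|v_5|`, as in Gauss reduction of binary forms: centre `v_6` modulo `v_5`, then swap
`v_4` and `v_5` if `v_4` has become the smaller. Positivity of `v_4 v_5 - 3 v_6²` keeps `v_5`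
nonzero. -/
theorem movesToReduced_aux (n : ℕ) : ∀ v : L, v 1 = 0 → v 3 = 0 → 0 < quad v →
    (v 5).natAbs = n → MovesToReduced v := by
  induction n using Nat.strong_induction_on with
  | _ n ih =>
  intro v h1 h3 hq hn
  have h5 : v 5 ≠ 0 := by
    intro h5
    simp only [quad, h1, h3, h5] at hq
    nlinarith [sq_nonneg (v 6)]
  obtain ⟨k, hk⟩ := exists_two_mul_abs_add_mul_le (v 6) h5
  obtain ⟨g, hg, hg0, hg2, t, hgv⟩ := exists_transvection_four v k
  refine MovesToReduced.of_map hg hg0 hg2 ?_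
  have hwq : 0 < quad (g v) := by rwa [quad_map hg]
  generalize g v = w at *
  by_cases ht : |v 5| ≤ |t|
  · obtain ⟨g', hg', hg'0, hg'2, hg'w⟩ := exists_shift w (by simp [hgv, h1]) (by simp [hgv, h3])
      (-(v 0 / v 5)) (-(v 2 / v 5))
    have hmod : ∀ x, x + -(x / v 5) * v 5 = x % v 5 := fun x => by
      linarith [Int.emod_add_mul_ediv x (v 5), mul_comm (v 5) (x / v 5)]
    have e : g' w = ![v 0 % v 5, 0, v 2 % v 5, 0, t, v 5, v 6 + k * v 5] := by
      rw [hg'w, ← hmod, ← hmod]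
      simp [hgv]
    refine ⟨g', hg', hg'0, hg'2, ?_⟩
    rw [e]
    exact ⟨⟨Int.emod_nonneg _ h5, Int.emod_lt_abs _ h5⟩,
      ⟨Int.emod_nonneg _ h5, Int.emod_lt_abs _ h5⟩, hk, ht⟩
  · obtain ⟨g', hg', hg'0, hg'2, hg'w⟩ := exists_swap_four w
    refine MovesToReduced.of_map hg' hg'0 hg'2 (ih _ ?_ _ ?_ ?_ (by rwa [quad_map hg']) rfl)
    · rw [← hn, ← Int.ofNat_lt, Int.natCast_natAbs, Int.natCast_natAbs, hg'w]
      simpa [hgv] using ht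
    · rw [hg'w]
      simp [hgv, h1]
    · rw [hg'w]
      simp [hgv, h3]

theorem movesToReduced {v : L} (h1 : v 1 = 0) (h3 : v 3 = 0) (hq : 0 < quad v) :
    MovesToReduced v :=
  movesToReduced_aux _ v h1 h3 hq rfl

/-- The submodule spanned by the first basis vectors of the first two hyperbolic planes. -/
def standardPlane : Submodule ℤ L where
  carrier := {x | x 1 = 0 ∧ x 3 = 0 ∧ x 4 = 0 ∧ x 5 = 0 ∧ x 6 = 0}
  zero_mem' := by simp
  add_mem' := by
    rintro x y ⟨h1, h3, h4, h5, h6⟩ ⟨h1', h3', h4', h5', h6'⟩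
    simp [*]
  smul_mem' := by
    rintro c x ⟨h1, h3, h4, h5, h6⟩
    simp [*]

theorem exists_reduced {h : L} (hq : 0 < quad h) {E : Submodule ℤ L}
    (hE : IsPrimitiveIsotropicPlane h E) :
    ∃ g ∈ spinorKernel, E.map (g : L →ₗ[ℤ] L) = standardPlane ∧ g h 1 = 0 ∧ g h 3 = 0 ∧
      g h 0 ∈ Set.Ico 0 |g h 5| ∧ g h 2 ∈ Set.Ico 0 |g h 5| ∧ 2 * |g h 6| ≤ |g h 5| ∧
      |g h 5| ≤ |g h 4| := by
  have hE' := hE.isSaturatedIsotropicPlane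
  obtain ⟨g, hg, h0, h2⟩ := hE'.exists_single_mem
  have horth : ∀ (k : L ≃ₗ[ℤ] L), k ∈ spinorKernel → ∀ x ∈ E.map (k : L →ₗ[ℤ] L),
      form x (k h) = 0 := by
    rintro k hk _ ⟨x, hx, rfl⟩
    exact (form_map hk x h).trans ((form_comm _ _).trans (hE.le_perp hx))
  have hv1 : ∀ k : L ≃ₗ[ℤ] L, k ∈ spinorKernel → Pi.single 0 1 ∈ E.map (k : L →ₗ[ℤ] L) →
      k h 1 = 0 := fun k hk hk0 => by simpa [form_apply] using horth k hk _ hk0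
  have hv3 : ∀ k : L ≃ₗ[ℤ] L, k ∈ spinorKernel → Pi.single 2 1 ∈ E.map (k : L →ₗ[ℤ] L) →
      k h 3 = 0 := fun k hk hk0 => by simpa [form_apply] using horth k hk _ hk0
  obtain ⟨k, hk, hk0, hk2, hkv⟩ := movesToReduced (hv1 g hg h0) (hv3 g hg h2)
    (by rwa [quad_map hg])
  have hkg := mul_mem hk hg
  have hmap : E.map ((k * g : L ≃ₗ[ℤ] L) : L →ₗ[ℤ] L)
      = (E.map (g : L →ₗ[ℤ] L)).map (k : L →ₗ[ℤ] L) :=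
    Submodule.map_comp (g : L →ₗ[ℤ] L) (k : L →ₗ[ℤ] L) E
  have h0' : Pi.single 0 1 ∈ E.map ((k * g : L ≃ₗ[ℤ] L) : L →ₗ[ℤ] L) := hmap ▸ ⟨_, h0, hk0⟩
  have h2' : Pi.single 2 1 ∈ E.map ((k * g : L ≃ₗ[ℤ] L) : L →ₗ[ℤ] L) := hmap ▸ ⟨_, h2, hk2⟩
  exact ⟨k * g, hkg, Submodule.ext ((hE'.map hkg).mem_iff h0' h2'), hv1 _ hkg h0', hv3 _ hkg h2',
    hkv⟩

/-! ### Counting reduced vectors -/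

/-- A finite set that contains the relevant coordinates of all reduced vectors of norm `2 p²`. -/
noncomputable def reducedCoordinates (p : ℕ) : Finset (ℤ × ℤ × ℤ × ℤ) :=
  Finset.Ico 0 (2 * (p : ℤ)) ×ˢ Finset.Ico 0 (2 * (p : ℤ)) ×ˢ
    Finset.Icc (-(2 * p : ℤ)) (2 * p) ×ˢ Finset.Icc (-(p : ℤ)) p

theorem card_reducedCoordinates (p : ℕ) :
    (reducedCoordinates p).card = 2 * p * (2 * p * ((4 * p + 1) * (2 * p + 1))) := by
  simp only [reducedCoordinates, Finset.card_product, Int.card_Ico, Int.card_Icc]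
  congr <;> omega

theorem mem_reducedCoordinates {p : ℕ} {v : L} (h1 : v 1 = 0) (h3 : v 3 = 0)
    (hq : quad v = (p : ℤ) ^ 2) (h0 : v 0 ∈ Set.Ico 0 |v 5|) (h2 : v 2 ∈ Set.Ico 0 |v 5|)
    (h6 : 2 * |v 6| ≤ |v 5|) (h5 : |v 5| ≤ |v 4|) :
    (v 0, v 2, v 5, v 6) ∈ reducedCoordinates p := by
  have hprod : |v 4| * |v 5| = p ^ 2 + 3 * |v 6| ^ 2 := by
    rw [quad, h1, h3] at hq
    rw [← abs_mul, sq_abs, abs_of_nonneg] <;> nlinarith [sq_nonneg (v 6), sq_nonneg (p : ℤ)]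
  have hb : |v 5| ≤ 2 * p := by
    by_contra hcon
    nlinarith [abs_nonneg (v 6), abs_nonneg (v 5)]
  have h5' := abs_le.1 hb
  have h6' : |v 6| ≤ p := by linarith
  have h6'' := abs_le.1 h6'
  simp only [reducedCoordinates, Finset.mem_product, Finset.mem_Ico, Finset.mem_Icc]
  exact ⟨⟨h0.1, h0.2.trans_le hb⟩, ⟨h2.1, h2.2.trans_le hb⟩, h5', h6''⟩

theorem boundaryCurve_finite_and_card_le {p : ℕ} (hp : 0 < p) {h : L}
    (hq : quad h = (p : ℤ) ^ 2) :
    Finite (BoundaryCurve h) ∧ Nat.card (BoundaryCurve h) ≤ (reducedCoordinates p).card := by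
  have hq0 : 0 < quad h := by rw [hq]; positivity
  choose g hg hmap h1 h3 h0 h2 h6 h5 using fun E : IsotropicPlane h => exists_reduced hq0 E.2
  let c : IsotropicPlane h → reducedCoordinates p := fun E =>
    ⟨_, mem_reducedCoordinates (h1 E) (h3 E) ((quad_map (hg E) h).trans hq) (h0 E) (h2 E) (h6 E)
      (h5 E)⟩
  have hc : ∀ E F, c E = c F → MulAction.orbitRel (orthogonalPlus h) (IsotropicPlane h) E F := by
    intro E F hEF
    have hEF' := Subtype.ext_iff.1 hEF
    simp only [c, Prod.mk.injEq] at hEF'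
    obtain ⟨e0, e2, e5, e6⟩ := hEF'
    -- The interval `[0, |v_5|)` contains `v_0`, so it is nonempty. With `v_5 ≠ 0`, the norm
    -- equation determines `v_4`.
    have hne : g F h 5 ≠ 0 := fun hz => by
      have := h0 F
      simp [hz] at this
    have hgh : g E h = g F h := by
      have hE := quad_map (hg E) h
      have hF := quad_map (hg F) h
      rw [quad, h1 E, h3 E, e5, e6] at hE
      rw [quad, h1 F, h3 F] at hF
      have e4 : g E h 4 = g F h 4 := mul_right_cancel₀ hne (by linarith)
      funext i
      fin_cases i
      exacts [e0, (h1 E).trans (h1 F).symm, e2, (h3 E).trans (h3 F).symm, e4, e5, e6]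
    have hk : (g E)⁻¹ * g F ∈ spinorKernel := mul_mem (inv_mem (hg E)) (hg F)
    have hkh : ((g E)⁻¹ * g F) h = h := by
      rw [LinearEquiv.mul_apply, ← hgh]
      exact (g E).symm_apply_apply h
    refine ⟨⟨_, hk.1, hkh, hk.2⟩, Subtype.ext ?_⟩
    have e : F.1.map (((g E)⁻¹ * g F : L ≃ₗ[ℤ] L) : L →ₗ[ℤ] L)
        = (F.1.map (g F : L →ₗ[ℤ] L)).map (((g E)⁻¹ : L ≃ₗ[ℤ] L) : L →ₗ[ℤ] L) :=
      Submodule.map_comp (g F : L →ₗ[ℤ] L) (((g E)⁻¹ : L ≃ₗ[ℤ] L) : L →ₗ[ℤ] L) F.1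
    change F.1.map (((g E)⁻¹ * g F : L ≃ₗ[ℤ] L) : L →ₗ[ℤ] L) = E.1
    rw [e, hmap F, ← hmap E, ← Submodule.map_comp]
    convert Submodule.map_id E.1
    exact LinearMap.ext fun x => (g E).symm_apply_apply x
  have hinj : Function.Injective fun B : BoundaryCurve h => c B.out := fun B C hBC => by
    rw [← Quotient.out_eq B, ← Quotient.out_eq C]
    exact Quotient.sound (hc _ _ hBC)
  refine ⟨Finite.of_injective _ hinj, ?_⟩
  simpa using Nat.card_le_card_of_injective _ hinj

end KummerLattice

theorem mainTheorem1 (p : ℕ) (hp : p.Prime) (hp3 : 3 < p)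
    (h : KummerLattice.L) (hprim : KummerLattice.IsPrimitive h) (hsplit : KummerLattice.IsSplit h)
    (hdeg : KummerLattice.form h h = 2 * (p : ℤ) ^ 2) :
    Finite (KummerLattice.BoundaryCurve h) ∧
      Nat.card (KummerLattice.BoundaryCurve h) ≤ 160 * (p ^ 5 + p ^ 2) := by
  have hq : KummerLattice.quad h = (p : ℤ) ^ 2 := by
    rw [KummerLattice.form_self] at hdeg
    linarith
  obtain ⟨hfin, hcard⟩ := KummerLattice.boundaryCurve_finite_and_card_le hp.pos hq
  refine ⟨hfin, hcard.trans ?_⟩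
  rw [KummerLattice.card_reducedCoordinates]
  -- The count is `32 p⁴ + 24 p³ + 4 p²`.
  have h5 : p ^ 4 ≤ p ^ 5 := Nat.pow_le_pow_right hp.pos (by norm_num)
  have h4 : p ^ 3 ≤ p ^ 5 := Nat.pow_le_pow_right hp.pos (by norm_num)
  nlinarith
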